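/- Fix $0<q<1$, $n\in\mathbb N=\{0,1,2,\dots\}$ and $\alpha\in\mathbb R$; put $v=(\alpha,\beta)$ with $\beta=-n$, $|v|=\alpha+\beta=\alpha-n$, and assume $|v|>-1$. Let $\mathbb R_q^+=\{q^m:m\in\mathbb Z\}$, let $$\int_0^\infty f(x)\,d_qx=(1-q)\sum_{m\in\mathbb Z}f(q^m)q^m$$ (when the sum converges absolutely), and let $\mathcal L_{q,2,v}$ be the space of complex functions $f$ with $\|f\|_{q,2,v}=\big(\int_0^\infty|f(x)|^2x^{2|v|+1}d_qx\big)^{1/2}<\infty$. Put $(a,q)_k=\prod_{i=0}^{k-1}(1-aq^i)$, $(a,q)_\infty=\prod_{i\ge0}(1-aq^i)$, $$j_\nu(x,q^2)=\sum_{k\ge0}(-1)^k\frac{q^{k(k+1)}}{(q^{2\nu+2},q^2)_k(q^2,q^2)_k}x^{2k},\qquad \widetilde j_{q,v}(x,q^2)=x^{-2\beta}j_{\alpha-\beta}(q^{-\beta}x,q^2),$$ $$c_{q,v}=\frac{q^{n(\alpha+n+1)}}{1-q}\,\frac{(q^{2\alpha+2},q^2)_\infty}{(q^2,q^2)_\infty\,(q^{2\alpha+2},q^2)_n},$$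 $$\mathcal F_{q,v}f(x)=c_{q,v}\int_0^\infty f(t)\,\widetilde j_{q,v}(tx,q^2)\,t^{2|v|+1}d_qt,$$ $$T^v_{q,x}f(y)=c_{q,v}\int_0^\infty\mathcal F_{q,v}f(t)\,\widetilde j_{q,v}(yt,q^2)\,\widetilde j_{q,v}(xt,q^2)\,t^{2|v|+1}d_qt.$$ A generalized $q$-Bessel wavelet is an even function $\Psi\in\mathcal L_{q,2,v}$ with $C_{v,\Psi}=\int_0^\infty|\mathcal F_{q,v}\Psi(a)|^2\frac{d_qa}{a}<\infty$. For such $\Psi$ and for $a,b\in\mathbb R_q^+$ put $\Psi_a(x)=a^{-(2|v|+2)}\Psi(x/a)$, $\Psi_{(a,b),v}=\sqrt a\,T^v_{q,b}(\Psi_a)$ and $$C^v_{q,\Psi}(f)(a,b)=c_{q,v}\int_0^\infty f(x)\,\overline{\Psi_{(a,b),v}(x)}\,x^{2|v|+1}d_qx,\qquad f\in\mathcal L_{q,2,v}.$$ **Theorem.** Let $\Psi$ be a generalized $q$-Bessel wavelet that does not vanish identically on $\mathbb R_q^+$. Then $C_{v,\Psi}>0$, $\Psi_a\in\mathcal L_{q,2,v}$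 for all $a\in\mathbb R_q^+$, the $q$-integrals above and below all converge absolutely (for all parameters in $\mathbb R_q^+$ and all $f,g\in\mathcal L_{q,2,v}$; for the translation, with $\Psi_a$ in place of $f$), and: 1. (Plancherel) for all $f\in\mathcal L_{q,2,v}$, $$\frac1{C_{v,\Psi}}\int_0^\infty\!\!\int_0^\infty|C^v_{q,\Psi}(f)(a,b)|^2\,b^{2|v|+1}\frac{d_qa\,d_qb}{a^2}=\|f\|_{q,2,v}^2;$$ 2. (Parseval) for all $f,g\in\mathcal L_{q,2,v}$, $$\int_0^\infty f(x)\overline{g(x)}\,x^{2|v|+1}d_qx=\frac1{C_{v,\Psi}}\int_0^\infty\!\!\int_0^\infty C^v_{q,\Psi}(f)(a,b)\,\overline{C^v_{q,\Psi}(g)(a,b)}\,b^{2|v|+1}\frac{d_qa\,d_qb}{a^2}.$$ -/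

import Mathlib

namespace QBessel

noncomputable section

/-- `R_q^+ = {q ^ m : m ∈ ℤ}`. -/
def lattice (q : ℝ) : Set ℝ := Set.range fun m : ℤ => q ^ m

/-- Absolute convergence of the Jackson `q`-integral of `f` over `(0, ∞)`. -/
def QIntegrable {E : Type*} [NormedAddCommGroup E] [NormedSpace ℝ E] (q : ℝ) (f : ℝ → E) : Prop :=
  Summable fun m : ℤ => ‖q ^ m • f (q ^ m)‖

/-- The Jackson `q`-integral `∫_0^∞ f(x) d_q x = (1 - q) ∑_{m ∈ ℤ} f(q^m) q^m`. -/
def qIntegral {E : Type*} [NormedAddCommGroup E] [NormedSpace ℝ E] (q : ℝ) (f : ℝ → E) : E :=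
  (1 - q) • ∑' m : ℤ, q ^ m • f (q ^ m)

/-- Absolute convergence of the double Jackson `q`-integral of `F(a, b)` over `(0, ∞)²`. -/
def QIntegrable₂ {E : Type*} [NormedAddCommGroup E] [NormedSpace ℝ E] (q : ℝ)
    (F : ℝ → ℝ → E) : Prop :=
  Summable fun p : ℤ × ℤ => ‖(q ^ p.1 * q ^ p.2) • F (q ^ p.1) (q ^ p.2)‖

/-- The double `q`-integral `∫_0^∞ ∫_0^∞ F(a, b) d_q a d_q b`. -/
def qIntegral₂ {E : Type*} [NormedAddCommGroup E] [NormedSpace ℝ E] (q : ℝ)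
    (F : ℝ → ℝ → E) : E :=
  qIntegral q fun b => qIntegral q fun a => F a b

/-- `(a, q)_n = ∏_{k < n} (1 - a q^k)`. -/
def qPoch (a q : ℝ) (n : ℕ) : ℝ := ∏ k ∈ Finset.range n, (1 - a * q ^ k)

/-- `(a, q)_∞ = ∏_{k ≥ 0} (1 - a q^k)`. -/
def qPochInf (a q : ℝ) : ℝ := ∏' k : ℕ, (1 - a * q ^ k)

/-- The normalized `q`-Bessel function `j_ν(x, q²)`. -/
def qBessel (q ν x : ℝ) : ℝ :=
  ∑' k : ℕ, (-1) ^ k * (q ^ (k * (k + 1)) /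
    (qPoch (q ^ (2 * ν + 2)) (q ^ 2) k * qPoch (q ^ 2) (q ^ 2) k)) * x ^ (2 * k)

/-- The generalized `q`-Bessel function `x^{-2β} j_{α-β}(q^{-β} x, q²)`. -/
def genQBessel (q α β x : ℝ) : ℝ :=
  x ^ (-2 * β) * qBessel q (α - β) (q ^ (-β) * x)

/-- `|v| = α + β` for `v = (α, β)` with `β = -n`. -/
def absV (α : ℝ) (n : ℕ) : ℝ := α + -(n : ℝ)

/-- The normalization constant `c_{q,v}` for `v = (α, -n)`. -/
def cConst (q α : ℝ) (n : ℕ) : ℝ :=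
  q ^ ((n : ℝ) * (α + n + 1)) * qPochInf (q ^ (2 * α + 2)) (q ^ 2) /
    ((1 - q) * qPochInf (q ^ 2) (q ^ 2) * qPoch (q ^ (2 * α + 2)) (q ^ 2) n)

/-- The weight `x^{2|v|+1}` for `v = (α, -n)`. -/
def weight (α : ℝ) (n : ℕ) (x : ℝ) : ℝ := x ^ (2 * absV α n + 1)

/-- Membership in `L_{q,p,v}`, `v = (α, -n)`. Only the values of `f` on `R_q^+` matter. -/
def MemLq (q p α : ℝ) (n : ℕ) (f : ℝ → ℂ) : Prop :=
  QIntegrable q fun x => ‖f x‖ ^ p * weight α n x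

/-- The norm of `L_{q,p,v}`, `v = (α, -n)`. -/
def normLq (q p α : ℝ) (n : ℕ) (f : ℝ → ℂ) : ℝ :=
  (qIntegral q fun x => ‖f x‖ ^ p * weight α n x) ^ (1 / p)

/-- The integrand of the Fourier transform `F_{q,v} f` at `x`. -/
def fourierIntegrand (q α : ℝ) (n : ℕ) (f : ℝ → ℂ) (x t : ℝ) : ℂ :=
  f t * (genQBessel q α (-n) (t * x) : ℂ) * (weight α n t : ℂ)

/-- The generalized `q`-Bessel Fourier transform `F_{q,v}`, `v = (α, -n)`. -/
def fourier (q α : ℝ) (n : ℕ) (f : ℝ → ℂ) (x : ℝ) : ℂ :=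
  (cConst q α n : ℂ) * qIntegral q (fourierIntegrand q α n f x)

/-- The integrand of the translate `T_{q,x}^v f` at `y`. -/
def translationIntegrand (q α : ℝ) (n : ℕ) (x : ℝ) (f : ℝ → ℂ) (y t : ℝ) : ℂ :=
  fourier q α n f t * (genQBessel q α (-n) (y * t) : ℂ) * (genQBessel q α (-n) (x * t) : ℂ) *
    (weight α n t : ℂ)

/-- The generalized `q`-Bessel translation `T_{q,x}^v f (y)`, `v = (α, -n)`. -/
def translation (q α : ℝ) (n : ℕ) (x : ℝ) (f : ℝ → ℂ) (y : ℝ) : ℂ :=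
  (cConst q α n : ℂ) * qIntegral q (translationIntegrand q α n x f y)

/-- The dilate `Ψ_a(x) = a^{-(2|v|+2)} Ψ(x / a)`. -/
def dilate (α : ℝ) (n : ℕ) (Ψ : ℝ → ℂ) (a x : ℝ) : ℂ :=
  ((1 / a ^ (2 * absV α n + 2) : ℝ) : ℂ) * Ψ (x / a)

/-- `Ψ_{(a,b),v}(x) = √a T_{q,b}^v(Ψ_a)(x)`. -/
def waveletCopy (q α : ℝ) (n : ℕ) (Ψ : ℝ → ℂ) (a b x : ℝ) : ℂ :=
  (Real.sqrt a : ℂ) * translation q α n b (dilate α n Ψ a) x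

/-- The integrand of the wavelet transform of `f` at `(a, b)`. -/
def waveletIntegrand (q α : ℝ) (n : ℕ) (Ψ f : ℝ → ℂ) (a b x : ℝ) : ℂ :=
  f x * (starRingEnd ℂ) (waveletCopy q α n Ψ a b x) * (weight α n x : ℂ)

/-- The continuous generalized `q`-Bessel wavelet transform `C_{q,Ψ}^v(f)(a, b)`. -/
def waveletTransform (q α : ℝ) (n : ℕ) (Ψ f : ℝ → ℂ) (a b : ℝ) : ℂ :=
  (cConst q α n : ℂ) * qIntegral q (waveletIntegrand q α n Ψ f a b)

/-- The admissibility constant `C_{v,Ψ} = ∫_0^∞ |F_{q,v} Ψ(a)|² d_q a / a`. -/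
def admConst (q α : ℝ) (n : ℕ) (Ψ : ℝ → ℂ) : ℝ :=
  qIntegral q fun a => ‖fourier q α n Ψ a‖ ^ 2 / a

/-- Generalized `q`-Bessel wavelets: even functions in `L_{q,2,v}` with `C_{v,Ψ} < ∞`. -/
structure IsWavelet (q α : ℝ) (n : ℕ) (Ψ : ℝ → ℂ) : Prop where
  even : Function.Even Ψ
  memLq : MemLq q 2 α n Ψ
  admissible : QIntegrable q fun a => ‖fourier q α n Ψ a‖ ^ 2 / a

end

end QBessel

open Filter Topology ComplexConjugate

namespace QBessel

/-! On the lattice everything becomes a statement about bilateral sequences. Weighting the values of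
`f` by `ratio` identifies the $q$-Lebesgue space with $\ell^2(\mathbb Z)$, and the Fourier transform
becomes, up to explicit factors, the Hankel matrix $h(m+k)$ with $h$ = `kernel`. The analytic core
is that this matrix is orthogonal (`hasSum_kernel_mul_kernel`).

To see this, put $p=q^2$ and $\sigma=q^{\alpha+n+1}<1$. The two $q$-exponentials satisfy
$E(x)e(x)=1$ for $|x|<1$ (`bigExp_mul_smallExp`), and $h$ is, up to a shift of the index, the
sequence of Fourier coefficients of $\overline{E(\sigma w)}\,e(\sigma w)$ on the circle
(`besselSeq_mul_bigExp`, `kernel_eq_besselSeq`). This function has modulus 1, so the shifts of $h$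
are orthonormal (`correlation_besselSeq`). Being symmetric as well, the Hankel matrix is an
isometric involution $H$ of $\ell^2(\mathbb Z)$ (`hankelIsometry`, `hankel_hankel`).

At scale $q^i$ and position $q^j$ the wavelet transform is, up to a factor,
$H(Hu\cdot\overline{P(i+\cdot)})(j)$, with $P$ the Fourier transform of the wavelet
(`waveletTransform_zpow`). Parseval for $H$ in $j$, then the shift invariance of
$\sum_i|P(i+k)|^2=C_{v,\Psi}/(1-q)$, then Parseval for $H$ again give the theorem
(`tsum_hankelWavelet_mul_conj`). -/

/-! ### The two $q$-exponentials. -/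

/-- The coefficients of the `q`-exponential `E_p(-x) = (x, p)_∞`. -/
noncomputable def bigCoeff (p : ℝ) (l : ℕ) : ℝ := (-1) ^ l * p ^ (l.choose 2) / qPoch p p l

/-- The coefficients of the `q`-exponential `e_p(x) = 1 / (x, p)_∞`. -/
noncomputable def smallCoeff (p : ℝ) (l : ℕ) : ℝ := 1 / qPoch p p l

lemma qPoch_succ (a p : ℝ) (l : ℕ) : qPoch a p (l + 1) = qPoch a p l * (1 - a * p ^ l) := by
  simp [qPoch, Finset.prod_range_succ]

lemma qPoch_pos {a p : ℝ} (ha : a < 1) (hp0 : 0 < p) (hp1 : p < 1) (l : ℕ) :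
    0 < qPoch a p l := by
  refine Finset.prod_pos fun k _ => ?_
  have h1 : p ^ k ≤ 1 := pow_le_one₀ hp0.le hp1.le
  have h2 : 0 < p ^ k := pow_pos hp0 k
  nlinarith

section
variable {p : ℝ} (hp0 : 0 < p) (hp1 : p < 1)
include hp0 hp1

lemma qPoch_self_ne (l : ℕ) : qPoch p p l ≠ 0 := (qPoch_pos hp1 hp0 hp1 l).ne'

lemma one_sub_pow_succ_pos (l : ℕ) : 0 < 1 - p ^ (l + 1) :=
  sub_pos.2 (pow_lt_one₀ hp0.le hp1 l.succ_ne_zero)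

lemma bigCoeff_succ (l : ℕ) :
    bigCoeff p (l + 1) * (1 - p ^ (l + 1)) = -(p ^ l * bigCoeff p l) := by
  have h := qPoch_self_ne hp0 hp1 l
  have h' := (one_sub_pow_succ_pos hp0 hp1 l).ne'
  have h'' : 1 - p * p ^ l ≠ 0 := by rwa [← pow_succ']
  rw [bigCoeff, bigCoeff, qPoch_succ, Nat.choose_succ_succ' l 1, Nat.choose_one_right]
  rw [pow_succ' p l]
  field_simp
  ring

lemma smallCoeff_succ (l : ℕ) :
    smallCoeff p (l + 1) * (1 - p ^ (l + 1)) = smallCoeff p l := by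
  have h := qPoch_self_ne hp0 hp1 l
  have h' := (one_sub_pow_succ_pos hp0 hp1 l).ne'
  have h'' : 1 - p * p ^ l ≠ 0 := by rwa [← pow_succ']
  rw [smallCoeff, smallCoeff, qPoch_succ, pow_succ' p l]
  field_simp

lemma tendsto_one_sub_pow_succ : Tendsto (fun l : ℕ => 1 - p ^ (l + 1)) atTop (𝓝 1) := by
  have := (tendsto_pow_atTop_nhds_zero_of_lt_one hp0.le hp1).comp (tendsto_add_atTop_nat 1)
  simpa using this.const_sub 1

lemma summable_abs_bigCoeff (x : ℝ) : Summable fun l => ‖bigCoeff p l * x ^ l‖ := by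
  refine Summable.norm (summable_of_ratio_norm_eventually_le (r := 1 / 2) (by norm_num) ?_)
  have h1 : Tendsto (fun l : ℕ => p ^ l * |x| / (1 - p ^ (l + 1))) atTop (𝓝 0) := by
    have := ((tendsto_pow_atTop_nhds_zero_of_lt_one hp0.le hp1).mul_const |x|).div
      (tendsto_one_sub_pow_succ hp0 hp1) one_ne_zero
    rwa [zero_mul, zero_div] at this
  filter_upwards [h1.eventually_le_const (show (0 : ℝ) < 1 / 2 by norm_num)] with l hl
  have hpos := one_sub_pow_succ_pos hp0 hp1 l
  have e : bigCoeff p (l + 1) * x ^ (l + 1) =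
      -(p ^ l * x / (1 - p ^ (l + 1))) * (bigCoeff p l * x ^ l) := by
    rw [eq_div_of_mul_eq hpos.ne' (bigCoeff_succ hp0 hp1 l)]
    ring
  rw [e, norm_mul]
  refine mul_le_mul_of_nonneg_right ?_ (norm_nonneg _)
  rw [norm_neg, norm_div, norm_mul, Real.norm_of_nonneg (pow_pos hp0 l).le,
    Real.norm_of_nonneg hpos.le]
  exact hl

lemma summable_abs_smallCoeff {x : ℝ} (hx : |x| < 1) :
    Summable fun l => ‖smallCoeff p l * x ^ l‖ := by
  -- The ratio of consecutive terms tends to $|x|$, so any $r$ strictly between $|x|$ and 1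
  -- eventually bounds it.
  obtain ⟨r, hr, hr1⟩ := exists_between hx
  refine Summable.norm (summable_of_ratio_norm_eventually_le (r := r) hr1 ?_)
  have h1 : Tendsto (fun l : ℕ => |x| / (1 - p ^ (l + 1))) atTop (𝓝 |x|) := by
    have := (tendsto_const_nhds (x := |x|)).div (tendsto_one_sub_pow_succ hp0 hp1) one_ne_zero
    rwa [div_one] at this
  filter_upwards [h1.eventually_le_const hr] with l hl
  have hpos := one_sub_pow_succ_pos hp0 hp1 l
  have e : smallCoeff p (l + 1) * x ^ (l + 1) =
      (x / (1 - p ^ (l + 1))) * (smallCoeff p l * x ^ l) := by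
    rw [eq_div_of_mul_eq hpos.ne' (smallCoeff_succ hp0 hp1 l)]
    ring
  rw [e, norm_mul]
  refine mul_le_mul_of_nonneg_right ?_ (norm_nonneg _)
  rw [norm_div, Real.norm_of_nonneg hpos.le]
  exact hl

end

section
variable {𝕜 : Type*} [NormedField 𝕜] [NormedAlgebra ℝ 𝕜] [CompleteSpace 𝕜]

/-- The entire function `∑ (-1)^l p^{l(l-1)/2} x^l / (p, p)_l`. -/
noncomputable def bigExp (p : ℝ) (x : 𝕜) : 𝕜 := ∑' l : ℕ, bigCoeff p l • x ^ l

/-- The function `∑ x^l / (p, p)_l` on the unit disc. -/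
noncomputable def smallExp (p : ℝ) (x : 𝕜) : 𝕜 := ∑' l : ℕ, smallCoeff p l • x ^ l

lemma tsum_mul_pow_continuousAt_zero (c : ℕ → ℝ) {r : ℝ} (hr : 0 < r)
    (hc : Summable fun l => ‖c l * r ^ l‖) :
    ContinuousAt (fun x : 𝕜 => ∑' l : ℕ, c l • x ^ l) 0 := by
  have : ContinuousOn (fun x : 𝕜 => ∑' l : ℕ, c l • x ^ l) (Metric.ball 0 r) := by
    refine continuousOn_tsum (fun l => by fun_prop) hc fun l x hx => ?_
    rw [mem_ball_zero_iff] at hx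
    rw [norm_smul, norm_pow, norm_mul, norm_pow, Real.norm_of_nonneg hr.le]
    gcongr
  exact this.continuousAt (Metric.ball_mem_nhds _ hr)

variable {p : ℝ} (hp0 : 0 < p) (hp1 : p < 1)
include hp0 hp1

omit [CompleteSpace 𝕜] in
lemma summable_norm_bigExp (x : 𝕜) : Summable fun l => ‖bigCoeff p l • x ^ l‖ := by
  simpa [norm_smul] using summable_abs_bigCoeff hp0 hp1 ‖x‖

omit [CompleteSpace 𝕜] in
lemma summable_norm_smallExp {x : 𝕜} (hx : ‖x‖ < 1) :
    Summable fun l => ‖smallCoeff p l • x ^ l‖ := by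
  simpa [norm_smul] using summable_abs_smallCoeff hp0 hp1 (x := ‖x‖) (by simpa using hx)

/-- The coefficient recursion `bigCoeff_succ`, read as a functional equation; iterating it produces
the finite products `qPoch`. -/
lemma bigExp_eq (x : 𝕜) : bigExp p x = (1 - x) * bigExp p (p • x) := by
  have h1 := (summable_norm_bigExp hp0 hp1 x).of_norm
  have h2 := (summable_norm_bigExp hp0 hp1 (p • x)).of_norm
  have h3 : bigExp p x - bigExp p (p • x) = - (x * bigExp p (p • x)) := by
    rw [bigExp, bigExp, ← h1.tsum_sub h2, (h1.sub h2).tsum_eq_zero_add, ← tsum_mul_left, ← tsum_neg]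
    simp only [pow_zero, sub_self, zero_add]
    refine tsum_congr fun l => ?_
    have := bigCoeff_succ hp0 hp1 l
    rw [smul_pow, smul_pow, smul_smul, smul_smul, ← sub_smul, mul_smul_comm, ← pow_succ',
      ← neg_smul]
    congr 1
    linear_combination this
  linear_combination h3

lemma smallExp_eq {x : 𝕜} (hx : ‖x‖ < 1) : smallExp p (p • x) = (1 - x) * smallExp p x := by
  have hx' : ‖p • x‖ < 1 := by
    rw [norm_smul, Real.norm_of_nonneg hp0.le]
    nlinarith [norm_nonneg x]
  have h1 := (summable_norm_smallExp hp0 hp1 hx).of_norm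
  have h2 := (summable_norm_smallExp hp0 hp1 hx').of_norm
  have h3 : smallExp p x - smallExp p (p • x) = x * smallExp p x := by
    rw [smallExp, smallExp, ← h1.tsum_sub h2, (h1.sub h2).tsum_eq_zero_add, ← tsum_mul_left]
    simp only [pow_zero, sub_self, zero_add]
    refine tsum_congr fun l => ?_
    have := smallCoeff_succ hp0 hp1 l
    rw [smul_pow, smul_smul, ← sub_smul, mul_smul_comm, ← pow_succ']
    congr 1
    linear_combination this
  linear_combination -h3

omit [CompleteSpace 𝕜] in
lemma tendsto_pow_smul_zero (x : 𝕜) : Tendsto (fun k : ℕ => p ^ k • x) atTop (𝓝 0) := by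
  simpa using (tendsto_pow_atTop_nhds_zero_of_lt_one hp0.le hp1).smul_const x

omit [CompleteSpace 𝕜] hp0 hp1 in
lemma bigExp_zero : bigExp p (0 : 𝕜) = 1 := by
  rw [bigExp, tsum_eq_single 0 fun l hl => by simp [hl]]
  simp [bigCoeff, qPoch]

omit [CompleteSpace 𝕜] hp0 hp1 in
lemma smallExp_zero : smallExp p (0 : 𝕜) = 1 := by
  rw [smallExp, tsum_eq_single 0 fun l hl => by simp [hl]]
  simp [smallCoeff, qPoch]

lemma tendsto_bigExp (x : 𝕜) :
    Tendsto (fun k : ℕ => bigExp p (p ^ k • x)) atTop (𝓝 1) := by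
  have h : ContinuousAt (bigExp (𝕜 := 𝕜) p) 0 :=
    tsum_mul_pow_continuousAt_zero _ one_pos (summable_abs_bigCoeff hp0 hp1 1)
  have := h.tendsto.comp (tendsto_pow_smul_zero hp0 hp1 x)
  rwa [bigExp_zero] at this

lemma tendsto_smallExp (x : 𝕜) :
    Tendsto (fun k : ℕ => smallExp p (p ^ k • x)) atTop (𝓝 1) := by
  have h : ContinuousAt (smallExp (𝕜 := 𝕜) p) 0 :=
    tsum_mul_pow_continuousAt_zero _ (r := 1 / 2) (by norm_num)
      (summable_abs_smallCoeff hp0 hp1 (by norm_num [abs_of_pos]))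
  have := h.tendsto.comp (tendsto_pow_smul_zero hp0 hp1 x)
  rwa [smallExp_zero] at this

/-- The two `q`-exponentials are inverse to each other. -/
lemma bigExp_mul_smallExp {x : 𝕜} (hx : ‖x‖ < 1) : bigExp p x * smallExp p x = 1 := by
  -- The functional equations make the product invariant under $x\mapsto px$, so it equals its limit
  -- at 0, which is 1.
  have key : ∀ k : ℕ, bigExp p (p ^ k • x) * smallExp p (p ^ k • x) =
      bigExp p x * smallExp p x := by
    intro k
    induction k with
    | zero => simp
    | succ k ih =>
      have hk : ‖p ^ k • x‖ < 1 := by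
        rw [norm_smul, Real.norm_of_nonneg (pow_pos hp0 k).le]
        have := pow_le_one₀ hp0.le hp1.le (n := k)
        nlinarith [norm_nonneg x]
      rw [← ih, pow_succ', mul_smul, smallExp_eq hp0 hp1 hk, bigExp_eq hp0 hp1 (p ^ k • x)]
      ring
  have h := (tendsto_bigExp hp0 hp1 x).mul (tendsto_smallExp hp0 hp1 x)
  simp only [key, mul_one] at h
  exact tendsto_nhds_unique tendsto_const_nhds h

lemma bigExp_eq_qPoch_mul (x : ℝ) (k : ℕ) :
    bigExp p x = qPoch x p k * bigExp p (p ^ k * x) := by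
  induction k with
  | zero => simp [qPoch]
  | succ k ih =>
    have := bigExp_eq hp0 hp1 (p ^ k * x)
    rw [smul_eq_mul] at this
    rw [ih, qPoch_succ, this, pow_succ']
    ring_nf

/-- Euler's product formula `(x, p)_∞ = ∑ (-1)^l p^{l(l-1)/2} x^l / (p, p)_l`. -/
lemma qPochInf_eq_bigExp (x : ℝ) : qPochInf x p = bigExp p x := by
  have hs : Summable fun k : ℕ => ‖-(x * p ^ k)‖ := by
    have := (summable_geometric_of_lt_one hp0.le hp1).mul_left |x|
    refine this.congr fun k => ?_
    rw [norm_neg, norm_mul, norm_pow, Real.norm_eq_abs, Real.norm_of_nonneg hp0.le]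
  have hm : Multipliable fun k : ℕ => 1 - x * p ^ k := by
    simpa [sub_eq_add_neg] using multipliable_one_add_of_summable hs
  have h1 : Tendsto (fun k => qPoch x p k) atTop (𝓝 (qPochInf x p)) :=
    hm.hasProd.tendsto_prod_nat
  have h2 := h1.mul (tendsto_bigExp hp0 hp1 x)
  simp only [smul_eq_mul, ← bigExp_eq_qPoch_mul hp0 hp1, mul_one] at h2
  exact tendsto_nhds_unique h2 tendsto_const_nhds

/-- The values of the `q`-exponential at integral powers of `p`. -/
lemma bigExp_zpow_succ (m : ℤ) :
    bigExp p (p ^ (m + 1)) = bigExp p p * (if 0 ≤ m then smallCoeff p m.toNat else 0) := by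
  split_ifs with h
  · lift m to ℕ using h
    have := bigExp_eq_qPoch_mul hp0 hp1 p m
    have e : p ^ ((m : ℤ) + 1) = p ^ m * p := by
      rw [zpow_add_one₀ hp0.ne', zpow_natCast]
    rw [this, e, smallCoeff, Int.toNat_natCast]
    field_simp [qPoch_self_ne hp0 hp1 m]
  · obtain ⟨j, hj⟩ := Int.eq_ofNat_of_zero_le (show 0 ≤ -(m + 1) by omega)
    -- For $m<0$ the product contains the vanishing factor $1-p^{m+1}p^j$ with $j=-(m+1)$.
    rw [bigExp_eq_qPoch_mul hp0 hp1 _ (j + 1), mul_zero, qPoch_succ]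
    have : p ^ (m + 1) * p ^ j = 1 := by
      rw [← zpow_natCast p j, ← zpow_add₀ hp0.ne']
      simp [← hj]
    simp [this]

lemma bigExp_ne_zero {x : ℝ} (hx : |x| < 1) : bigExp p x ≠ 0 :=
  left_ne_zero_of_mul_eq_one (bigExp_mul_smallExp hp0 hp1 (by simpa using hx))

end

/-! ### Absolutely convergent Fourier series and correlations. -/

/-- The Fourier series with coefficients `a`, as a continuous function on the circle. -/
noncomputable def fourierSum (a : ℤ → ℝ) : C(AddCircle (1 : ℝ), ℂ) := ∑' l : ℤ, a l • _root_.fourier l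

/-- The correlation of two bilateral sequences. -/
noncomputable def correlation (a b : ℤ → ℝ) (d : ℤ) : ℝ := ∑' l : ℤ, a l * b (d + l)

lemma summable_norm_smul_fourier {a : ℤ → ℝ} (ha : Summable fun l => ‖a l‖) :
    Summable fun l => ‖a l • (_root_.fourier l : C(AddCircle (1 : ℝ), ℂ))‖ := by
  simpa [norm_smul, fourier_norm] using ha

lemma star_fourier (l : ℤ) :
    star (_root_.fourier l : C(AddCircle (1 : ℝ), ℂ)) = _root_.fourier (-l) := by
  ext θ
  rw [fourier_neg]
  rfl

lemma star_fourierSum {a : ℤ → ℝ} :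
    star (fourierSum a) = ∑' l : ℤ, a l • (_root_.fourier (-l) : C(AddCircle (1 : ℝ), ℂ)) := by
  rw [fourierSum, tsum_star]
  simp [star_smul, star_fourier]

/-- Shearing `(d, l) ↦ (l, d + l)` of `ℤ × ℤ`. -/
def shear : ℤ × ℤ ≃ ℤ × ℤ where
  toFun x := (x.2, x.1 + x.2)
  invFun x := (x.2 - x.1, x.1)
  left_inv x := by simp
  right_inv x := by simp

lemma summable_correlation_prod {a b : ℤ → ℝ} (ha : Summable fun l => ‖a l‖)
    (hb : Summable fun l => ‖b l‖) :
    Summable fun x : ℤ × ℤ => ‖a x.2 * b (x.1 + x.2)‖ :=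
  (shear.summable_iff (f := fun x : ℤ × ℤ => ‖a x.1 * b x.2‖)).2 (ha.mul_norm hb)

lemma summable_norm_correlation {a b : ℤ → ℝ} (ha : Summable fun l => ‖a l‖)
    (hb : Summable fun l => ‖b l‖) : Summable fun d => ‖correlation a b d‖ := by
  have h := summable_correlation_prod ha hb
  exact Summable.of_nonneg_of_le (fun _ => norm_nonneg _)
    (fun d => norm_tsum_le_tsum_norm (h.prod_factor d)) h.prod

/-- The coefficients are real, so conjugation only reverses frequencies; the terms
$w^{-l}w^{d+l}=w^d$ are then collected along the fibres of `shear`. -/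
lemma fourierSum_correlation {a b : ℤ → ℝ} (ha : Summable fun l => ‖a l‖)
    (hb : Summable fun l => ‖b l‖) :
    fourierSum (correlation a b) = star (fourierSum a) * fourierSum b := by
  have ha' : Summable fun l => ‖a l • (_root_.fourier (-l) : C(AddCircle (1 : ℝ), ℂ))‖ := by
    simpa [norm_smul, fourier_norm] using ha
  have hb' := summable_norm_smul_fourier hb
  have h1 := (summable_mul_of_summable_norm ha' hb').hasSum
  rw [← tsum_mul_tsum_of_summable_norm ha' hb', ← star_fourierSum] at h1
  have h2 := (shear.hasSum_iff).2 h1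
  have h3 := h2.prod_fiberwise (g := fun d => correlation a b d • _root_.fourier d) ?_
  · exact h3.tsum_eq
  · intro d
    have h4 := ((summable_correlation_prod ha hb).prod_factor d).of_norm.hasSum
    refine (h4.smul_const (_root_.fourier d : C(AddCircle (1 : ℝ), ℂ))).congr_fun ?_
    intro l
    simp only [Function.comp_apply, shear, Equiv.coe_fn_mk]
    rw [smul_mul_smul_comm]
    congr 1
    ext θ
    rw [ContinuousMap.mul_apply, ← fourier_add]
    congr 2
    ring

lemma eq_of_fourierSum_eq_one {a : ℤ → ℝ} (ha : Summable fun l => ‖a l‖)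
    (h : fourierSum a = 1) (d : ℤ) : a d = if d = 0 then 1 else 0 := by
  -- The $d$-th Fourier coefficient as a continuous functional, which may be applied term by term.
  let L : C(AddCircle (1 : ℝ), ℂ) →L[ℝ] ℂ :=
    ((innerSL ℂ (fourierLp (T := 1) 2 d)).comp
      (ContinuousMap.toLp 2 AddCircle.haarAddCircle ℂ)).restrictScalars ℝ
  have hL : ∀ m : ℤ, L (_root_.fourier m) = if d = m then 1 else 0 := fun m =>
    (orthonormal_iff_ite.1 (orthonormal_fourier (T := 1))) d m
  have h1 := ((summable_norm_smul_fourier ha).of_norm.hasSum.mapL L).tsum_eq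
  have h2 : (1 : C(AddCircle (1 : ℝ), ℂ)) = _root_.fourier 0 := by
    ext θ; simp
  change ∑' l, L (a l • _root_.fourier l) = L (fourierSum a) at h1
  rw [h, h2, hL, tsum_eq_single d] at h1
  · rw [map_smul, hL, if_pos rfl] at h1
    split_ifs at h1 ⊢ <;> simpa using h1
  · intro l hl
    rw [map_smul, hL, if_neg hl.symm, smul_zero]

/-- Extension by zero of a sequence on `ℕ` to `ℤ`. -/
def extendZero (a : ℕ → ℝ) (m : ℤ) : ℝ := if 0 ≤ m then a m.toNat else 0

lemma extendZero_natCast (a : ℕ → ℝ) (m : ℕ) : extendZero a m = a m := by simp [extendZero]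

lemma extendZero_of_notMem (a : ℕ → ℝ) {m : ℤ} (hm : m ∉ Set.range ((↑) : ℕ → ℤ)) :
    extendZero a m = 0 := by
  rw [extendZero, if_neg]
  intro h
  exact hm ⟨m.toNat, Int.toNat_of_nonneg h⟩

lemma summable_extendZero {a : ℕ → ℝ} (ha : Summable fun l => ‖a l‖) :
    Summable fun l => ‖extendZero a l‖ := by
  rw [← Nat.cast_injective.summable_iff fun m hm => by rw [extendZero_of_notMem a hm, norm_zero]]
  simpa [Function.comp_def, extendZero_natCast] using ha

lemma fourierSum_extendZero_apply {a : ℕ → ℝ} (ha : Summable fun l => ‖a l‖)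
    (θ : AddCircle (1 : ℝ)) :
    fourierSum (extendZero a) θ = ∑' l : ℕ, a l • (_root_.fourier 1 θ) ^ l := by
  rw [fourierSum, ← ContinuousMap.tsum_apply
    (summable_norm_smul_fourier (summable_extendZero ha)).of_norm,
    ← Nat.cast_injective.tsum_eq (f := fun l : ℤ =>
      (extendZero a l • (_root_.fourier l : C(AddCircle (1 : ℝ), ℂ))) θ)]
  · refine tsum_congr fun l => ?_
    rw [extendZero_natCast, ContinuousMap.smul_apply]
    congr 1
    simp [fourier_apply, AddCircle.toCircle_nsmul]
  · intro m hm
    by_contra h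
    exact hm (by simp [extendZero_of_notMem a h])

/-! ### The Bessel sequence and its autocorrelation. -/

/-- The sequence `σ^r (σ², p)_∞ / (p, p)_∞ · j_ν(p^{r/2})`, in the form of a correlation of the
coefficients of the two `q`-exponentials. -/
noncomputable def besselSeq (p σ : ℝ) : ℤ → ℝ :=
  correlation (extendZero fun l => bigCoeff p l * σ ^ l) (extendZero fun l => smallCoeff p l * σ ^ l)

lemma summable_norm_besselSeq {p σ : ℝ} (hp0 : 0 < p) (hp1 : p < 1) (hσ : |σ| < 1) :
    Summable fun d => ‖besselSeq p σ d‖ :=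
  summable_norm_correlation (summable_extendZero (summable_abs_bigCoeff hp0 hp1 σ))
    (summable_extendZero (summable_abs_smallCoeff hp0 hp1 hσ))

/-- The autocorrelation has symbol $|\overline{E(\sigma w)}\,e(\sigma w)|^2=|E(\sigma w)e(\sigma
w)|^2=1$ on the unit circle. -/
lemma correlation_besselSeq {p σ : ℝ} (hp0 : 0 < p) (hp1 : p < 1) (hσ : |σ| < 1) (d : ℤ) :
    correlation (besselSeq p σ) (besselSeq p σ) d = if d = 0 then 1 else 0 := by
  have ha := summable_abs_bigCoeff hp0 hp1 σ
  have hb := summable_abs_smallCoeff hp0 hp1 hσ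
  have hab := summable_norm_besselSeq hp0 hp1 hσ
  refine eq_of_fourierSum_eq_one (summable_norm_correlation hab hab) ?_ d
  rw [fourierSum_correlation hab hab, besselSeq,
    fourierSum_correlation (summable_extendZero ha) (summable_extendZero hb)]
  ext θ
  simp only [ContinuousMap.mul_apply, ContinuousMap.star_apply, ContinuousMap.one_apply, star_mul,
    star_star]
  rw [fourierSum_extendZero_apply ha, fourierSum_extendZero_apply hb]
  set w : ℂ := _root_.fourier 1 θ with hw
  have hnorm : ‖σ • w‖ < 1 := by
    rw [norm_smul, hw, fourier_apply, Circle.norm_coe, mul_one]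
    exact hσ
  have e1 : ∑' l : ℕ, (bigCoeff p l * σ ^ l) • w ^ l = bigExp p (σ • w) :=
    tsum_congr fun l => by rw [smul_pow, smul_smul]
  have e2 : ∑' l : ℕ, (smallCoeff p l * σ ^ l) • w ^ l = smallExp p (σ • w) :=
    tsum_congr fun l => by rw [smul_pow, smul_smul]
  rw [e1, e2]
  have h := bigExp_mul_smallExp hp0 hp1 hnorm
  have h' := congrArg star h
  rw [star_mul, star_one] at h'
  linear_combination (bigExp p (σ • w)) * (smallExp p (σ • w)) * h' + h

/-- The symmetry of `∑ (-1)^k p^{k(k-1)/2} z^k (p^k s, p)_∞ / (p, p)_k` in `s` and `z`. -/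
lemma tsum_bigCoeff_mul_bigExp_comm {p : ℝ} (hp0 : 0 < p) (hp1 : p < 1) (s z : ℝ) :
    ∑' k : ℕ, bigCoeff p k * z ^ k * bigExp p (p ^ k * s) =
      ∑' l : ℕ, bigCoeff p l * s ^ l * bigExp p (p ^ l * z) := by
  -- The double series has terms $a_ka_l\,p^{kl}z^ks^l$, $a_k$ = `bigCoeff p k`, symmetric under
  -- exchanging $(k,z)$ and $(l,s)$; $p^{kl}\le1$ gives absolute convergence.
  have hs : Summable fun x : ℕ × ℕ =>
      bigCoeff p x.1 * z ^ x.1 * (bigCoeff p x.2 * (p ^ x.1 * s) ^ x.2) := by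
    refine Summable.of_norm_bounded
      ((summable_abs_bigCoeff hp0 hp1 z).mul_norm (summable_abs_bigCoeff hp0 hp1 s)) fun x => ?_
    rw [norm_mul (bigCoeff p x.1 * z ^ x.1), norm_mul (bigCoeff p x.1 * z ^ x.1)]
    refine mul_le_mul_of_nonneg_left ?_ (norm_nonneg _)
    rw [mul_pow, mul_left_comm, norm_mul (_ ^ _), ← pow_mul, Real.norm_of_nonneg (pow_pos hp0 _).le]
    exact mul_le_of_le_one_left (norm_nonneg _) (pow_le_one₀ hp0.le hp1.le)
  have h1 : ∀ k, bigCoeff p k * z ^ k * bigExp p (p ^ k * s) =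
      ∑' l, bigCoeff p k * z ^ k * (bigCoeff p l * (p ^ k * s) ^ l) := fun k => by
    rw [tsum_mul_left]; rfl
  have h2 : ∀ l, bigCoeff p l * s ^ l * bigExp p (p ^ l * z) =
      ∑' k, bigCoeff p k * z ^ k * (bigCoeff p l * (p ^ k * s) ^ l) := fun l => by
    rw [bigExp, ← tsum_mul_left]
    refine tsum_congr fun k => ?_
    simp only [smul_eq_mul, mul_pow, ← pow_mul, mul_comm k l]
    ring
  rw [tsum_congr h1, tsum_congr h2]
  exact hs.prod_symm.tsum_comm

/-- After the symmetry, $E$ is evaluated only at the powers $p^{r+l+1}$. There it equals $E(p)$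
times a coefficient of $e$, or 0 when $r+l<0$, which is exactly the zero-extended sequence in the
correlation. -/
lemma besselSeq_mul_bigExp {p σ : ℝ} (hp0 : 0 < p) (hp1 : p < 1) (hσ : 0 < σ) (r : ℤ) :
    besselSeq p σ r * bigExp p p =
      σ ^ r * ∑' k : ℕ, bigCoeff p k * (p ^ (r + 1)) ^ k * bigExp p (p ^ k * σ ^ 2) := by
  rw [tsum_bigCoeff_mul_bigExp_comm hp0 hp1, besselSeq, correlation,
    ← Nat.cast_injective.tsum_eq (f := fun l : ℤ => extendZero (fun l => bigCoeff p l * σ ^ l) l *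
      extendZero (fun l => smallCoeff p l * σ ^ l) (r + l)), ← tsum_mul_right, ← tsum_mul_left]
  · refine tsum_congr fun l => ?_
    have e : p ^ l * p ^ (r + 1) = p ^ ((r + l) + 1) := by
      rw [← zpow_natCast p l, ← zpow_add₀ hp0.ne']
      ring_nf
    rw [e, bigExp_zpow_succ hp0 hp1, extendZero_natCast, extendZero]
    split_ifs with h
    · have e2 : σ ^ (r + l).toNat = σ ^ r * σ ^ l := by
        rw [← zpow_natCast, Int.toNat_of_nonneg h, zpow_add₀ hσ.ne', zpow_natCast]
      rw [e2]
      ring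
    · simp
  · intro m hm
    by_contra h
    exact hm (by simp [extendZero_of_notMem _ h])

/-! ### The $q$-Bessel kernel on the lattice and its orthogonality. -/

lemma rpow_zpow_comm {q : ℝ} (hq : 0 < q) (x : ℝ) (m : ℤ) :
    (q ^ m) ^ x = (q ^ x) ^ m := by
  rw [← Real.rpow_intCast, ← Real.rpow_intCast, ← Real.rpow_mul hq.le, ← Real.rpow_mul hq.le,
    mul_comm]

lemma pow_mul_succ_eq (q : ℝ) (k : ℕ) :
    q ^ (k * (k + 1)) = (q ^ 2) ^ (k.choose 2) * (q ^ 2) ^ k := by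
  rw [← pow_mul, ← pow_mul, ← pow_add]
  congr 1
  have := Nat.triangle_succ k
  have h2 := Nat.choose_two_right (k + 1)
  have h3 := Nat.choose_succ_succ' k 1
  rw [Nat.choose_one_right] at h3
  have h4 : 2 ∣ (k + 1) * (k + 1 - 1) := (Nat.even_mul_pred_self (k + 1)).two_dvd
  obtain ⟨c, hc⟩ := h4
  simp only [Nat.add_sub_cancel] at hc h2
  rw [hc] at h2
  nlinarith [Nat.mul_div_cancel_left c (show 0 < 2 by norm_num)]

section
variable {q : ℝ} (hq0 : 0 < q) (hq1 : q < 1)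
include hq0 hq1

lemma qBessel_zpow {ν : ℝ} (hν : -1 < ν) (r : ℤ) :
    qPochInf (q ^ (2 * ν + 2)) (q ^ 2) * qBessel q ν (q ^ r) * (q ^ (ν + 1)) ^ r =
      besselSeq (q ^ 2) (q ^ (ν + 1)) r * qPochInf (q ^ 2) (q ^ 2) := by
  have hp0 : 0 < q ^ 2 := by positivity
  have hp1 : q ^ 2 < 1 := pow_lt_one₀ hq0.le hq1 two_ne_zero
  have hs1 : q ^ (2 * ν + 2) < 1 := Real.rpow_lt_one hq0.le hq1 (by linarith)
  have hs : (q ^ (ν + 1)) ^ 2 = q ^ (2 * ν + 2) := by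
    rw [← Real.rpow_natCast, ← Real.rpow_mul hq0.le]
    congr 1; push_cast; ring
  rw [qPochInf_eq_bigExp hp0 hp1 (q ^ 2),
    besselSeq_mul_bigExp hp0 hp1 (Real.rpow_pos_of_pos hq0 _), hs, mul_comm]
  congr 1
  rw [qBessel, ← tsum_mul_left]
  refine tsum_congr fun k => ?_
  -- Splitting off $k$ factors of the infinite product cancels the Pochhammer symbol in the $k$-th
  -- denominator of the Bessel series.
  rw [qPochInf_eq_bigExp hp0 hp1, bigExp_eq_qPoch_mul hp0 hp1 _ k, bigCoeff, pow_mul_succ_eq]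
  have h1 := (qPoch_pos hs1 hp0 hp1 k).ne'
  have h2 := qPoch_self_ne hp0 hp1 k
  have e : ((q ^ 2) ^ (r + 1)) ^ k = (q ^ r) ^ (2 * k) * (q ^ 2) ^ k := by
    rw [zpow_add_one₀ hp0.ne', mul_pow, ← zpow_natCast q 2, zpow_comm, zpow_natCast, ← pow_mul]
  rw [e]
  generalize q ^ (2 * ν + 2) = S at *
  field_simp

/-- `(1 - q) c_{q,v}`, the constant in front of the sums over the lattice. -/
noncomputable def kernelConst (q α : ℝ) (n : ℕ) : ℝ := cConst q α n * (1 - q)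

/-- `q^{|v|+1}`. -/
noncomputable def ratio (q α : ℝ) (n : ℕ) : ℝ := q ^ (absV α n + 1)

/-- The kernel `(1 - q) c_{q,v} q^{s(|v|+1)} \widetilde j_{q,v}(q^s)` of the Fourier transform. -/
noncomputable def kernel (q α : ℝ) (n : ℕ) (s : ℤ) : ℝ :=
  kernelConst q α n * genQBessel q α (-n) (q ^ s) * ratio q α n ^ s

omit hq1 in
lemma ratio_pos (α : ℝ) (n : ℕ) : 0 < ratio q α n := Real.rpow_pos_of_pos hq0 _

variable {α : ℝ} {n : ℕ} (hv : -1 < absV α n)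
include hv

omit hv in
lemma qPochInf_shift :
    qPochInf (q ^ (2 * α + 2)) (q ^ 2) =
      qPoch (q ^ (2 * α + 2)) (q ^ 2) n * qPochInf (q ^ (2 * (α + n) + 2)) (q ^ 2) := by
  have hp0 : 0 < q ^ 2 := by positivity
  have hp1 : q ^ 2 < 1 := pow_lt_one₀ hq0.le hq1 two_ne_zero
  rw [qPochInf_eq_bigExp hp0 hp1, qPochInf_eq_bigExp hp0 hp1, bigExp_eq_qPoch_mul hp0 hp1 _ n]
  congr 2
  rw [← pow_mul, ← Real.rpow_natCast, ← Real.rpow_add hq0]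
  congr 1; push_cast; ring

/-- The finite symbol in $c_{q,v}$ turns the parameter $\alpha$ into the Bessel index $\alpha+n$. -/
lemma kernelConst_eq :
    kernelConst q α n = (q ^ (α + n + 1)) ^ n * qPochInf (q ^ (2 * (α + n) + 2)) (q ^ 2) /
      qPochInf (q ^ 2) (q ^ 2) := by
  have hp0 : 0 < q ^ 2 := by positivity
  have hp1 : q ^ 2 < 1 := pow_lt_one₀ hq0.le hq1 two_ne_zero
  have hn : (0 : ℝ) ≤ n := n.cast_nonneg
  have hα : -1 < α := by rw [absV] at hv; linarith
  have hs1 : q ^ (2 * α + 2) < 1 := Real.rpow_lt_one hq0.le hq1 (by linarith)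
  have h1 := (qPoch_pos hs1 hp0 hp1 n).ne'
  have h2 : 1 - q ≠ 0 := by linarith
  have e : q ^ ((n : ℝ) * (α + n + 1)) = (q ^ (α + n + 1)) ^ n := by
    rw [mul_comm, Real.rpow_mul hq0.le, Real.rpow_natCast]
  have h3 : qPochInf (q ^ 2) (q ^ 2) ≠ 0 := by
    rw [qPochInf_eq_bigExp hp0 hp1]
    exact bigExp_ne_zero hp0 hp1 (by rwa [abs_of_pos hp0])
  rw [kernelConst, cConst, qPochInf_shift hq0 hq1 (n := n), e]
  generalize q ^ (2 * α + 2) = S, q ^ (2 * (α + n) + 2) = S' at *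
  field_simp

lemma kernelConst_ne_zero : kernelConst q α n ≠ 0 := by
  have hp0 : 0 < q ^ 2 := by positivity
  have hp1 : q ^ 2 < 1 := pow_lt_one₀ hq0.le hq1 two_ne_zero
  have hn : (0 : ℝ) ≤ n := n.cast_nonneg
  have hα : -1 < α + n := by rw [absV] at hv; linarith
  have hs1 : q ^ (2 * (α + n) + 2) < 1 := Real.rpow_lt_one hq0.le hq1 (by linarith)
  rw [kernelConst_eq hq0 hq1 hv, qPochInf_eq_bigExp hp0 hp1, qPochInf_eq_bigExp hp0 hp1]
  refine div_ne_zero (mul_ne_zero (pow_pos (Real.rpow_pos_of_pos hq0 _) _).ne'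
    (bigExp_ne_zero hp0 hp1 ?_)) (bigExp_ne_zero hp0 hp1 (by rwa [abs_of_pos hp0]))
  rwa [abs_of_pos (Real.rpow_pos_of_pos hq0 _)]

/-- The argument $q^{-\beta}q^s=q^{n+s}$ shifts the index by $n$. The factor $x^{2n}$ raises the
weight exponent $\alpha-n+1$ to $\alpha+n+1$, and the power $\sigma^n$ in the constant completes
$\sigma^{n+s}$. -/
lemma kernel_eq_besselSeq (s : ℤ) :
    kernel q α n s = besselSeq (q ^ 2) (q ^ (α + n + 1)) (n + s) := by
  have hp0 : 0 < q ^ 2 := by positivity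
  have hp1 : q ^ 2 < 1 := pow_lt_one₀ hq0.le hq1 two_ne_zero
  have hn : (0 : ℝ) ≤ n := n.cast_nonneg
  have hα : -1 < α + n := by rw [absV] at hv; linarith
  have h3 : qPochInf (q ^ 2) (q ^ 2) ≠ 0 := by
    rw [qPochInf_eq_bigExp hp0 hp1]
    exact bigExp_ne_zero hp0 hp1 (by rwa [abs_of_pos hp0])
  have hB := qBessel_zpow hq0 hq1 hα (n + s)
  have e1 : q ^ (-(-(n : ℝ))) * q ^ s = q ^ ((n : ℤ) + s) := by
    rw [neg_neg, Real.rpow_natCast, zpow_add₀ hq0.ne', zpow_natCast]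
  have e2 : (q ^ s) ^ (-2 * -(n : ℝ)) * ratio q α n ^ s = (q ^ (α + n + 1)) ^ s := by
    rw [rpow_zpow_comm hq0, ratio, ← mul_zpow, ← Real.rpow_add hq0, absV]
    congr 2; ring
  have e3 : (q ^ (α + n + 1)) ^ ((n : ℤ) + s) = (q ^ (α + n + 1)) ^ n * (q ^ (α + n + 1)) ^ s := by
    rw [zpow_add₀ (Real.rpow_pos_of_pos hq0 _).ne', zpow_natCast]
  rw [e3] at hB
  rw [← mul_left_inj' h3, ← hB, kernel, genQBessel, kernelConst_eq hq0 hq1 hv, e1, ← e2,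
    sub_neg_eq_add]
  field_simp

/-- Orthogonality of the `q`-Bessel functions. -/
lemma hasSum_kernel_mul_kernel (k l : ℤ) :
    HasSum (fun m => kernel q α n (m + k) * kernel q α n (m + l)) (if k = l then 1 else 0) := by
  have hp0 : 0 < q ^ 2 := by positivity
  have hp1 : q ^ 2 < 1 := pow_lt_one₀ hq0.le hq1 two_ne_zero
  have hn : (0 : ℝ) ≤ n := n.cast_nonneg
  have hα : 0 < α + n + 1 := by rw [absV] at hv; linarith
  have hσ : |q ^ (α + n + 1)| < 1 := by
    rw [abs_of_pos (Real.rpow_pos_of_pos hq0 _)]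
    exact Real.rpow_lt_one hq0.le hq1 hα
  have hab := summable_norm_besselSeq hp0 hp1 hσ
  have h := ((summable_correlation_prod hab hab).prod_factor (l - k)).of_norm.hasSum
  have h2 := correlation_besselSeq hp0 hp1 hσ (l - k)
  rw [correlation] at h2
  rw [h2] at h
  have h3 := (Equiv.addRight (n + k : ℤ)).hasSum_iff.2 h
  simp only [Function.comp_def, Equiv.coe_addRight, sub_eq_zero] at h3
  simp only [kernel_eq_besselSeq hq0 hq1 hv, eq_comm (a := k)]
  refine h3.congr_fun fun m => ?_
  congr 2 <;> ring

end

/-! ### Square-summable sequences and the Hankel isometry. -/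

section SquareSummable
variable {ι : Type*} {u v : ι → ℂ}

lemma summable_norm_mul_of_sq (hu : Summable fun m => ‖u m‖ ^ 2) (hv : Summable fun m => ‖v m‖ ^ 2) :
    Summable fun m => ‖u m * v m‖ := by
  refine Summable.of_nonneg_of_le (fun _ => norm_nonneg _) (fun m => ?_) (hu.add hv)
  rw [norm_mul]
  nlinarith [sq_nonneg (‖u m‖ - ‖v m‖), sq_nonneg ‖u m‖, sq_nonneg ‖v m‖]

lemma summable_mul_conj_of_sq (hu : Summable fun m => ‖u m‖ ^ 2)
    (hv : Summable fun m => ‖v m‖ ^ 2) : Summable fun m => ‖u m * conj (v m)‖ :=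
  summable_norm_mul_of_sq hu (v := fun m => conj (v m)) (by simpa using hv)

lemma memℓp_two_of_sq (hu : Summable fun m => ‖u m‖ ^ 2) : Memℓp u 2 := by
  refine memℓp_gen ?_
  simpa using hu

lemma sq_of_memℓp_two (hu : Memℓp u 2) : Summable fun m => ‖u m‖ ^ 2 := by
  simpa using hu.summable (by simp)

lemma exists_norm_sq_le (hu : Summable fun m => ‖u m‖ ^ 2) : ∃ C, ∀ m, ‖u m‖ ^ 2 ≤ C :=
  ⟨_, fun m => hu.le_tsum m fun _ _ => sq_nonneg _⟩

/-- A square-summable factor is bounded. -/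
lemma summable_sq_mul (hu : Summable fun m => ‖u m‖ ^ 2) (hv : Summable fun m => ‖v m‖ ^ 2) :
    Summable fun m => ‖u m * v m‖ ^ 2 := by
  obtain ⟨C, hC⟩ := exists_norm_sq_le hv
  refine Summable.of_nonneg_of_le (fun _ => sq_nonneg _) (fun m => ?_) (hu.mul_right C)
  rw [norm_mul, mul_pow]
  exact mul_le_mul_of_nonneg_left (hC m) (sq_nonneg _)

end SquareSummable

/-- The transform with kernel `h (m + k)` on bilateral sequences. -/
noncomputable def hankel (h : ℤ → ℝ) (u : ℤ → ℂ) (k : ℤ) : ℂ := ∑' m : ℤ, u m * (h (m + k) : ℂ)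

section Hankel
variable {h : ℤ → ℝ}
  (hh : ∀ k l : ℤ, HasSum (fun m => h (m + k) * h (m + l)) (if k = l then 1 else 0))
include hh

lemma summable_sq_shift (k : ℤ) : Summable fun m => ‖(h (m + k) : ℂ)‖ ^ 2 := by
  simpa [sq] using (hh k k).summable

/-- The row of index `k` of the Hankel matrix. -/
noncomputable def hankelRow (k : ℤ) : lp (fun _ : ℤ => ℂ) 2 :=
  ⟨fun m => h (m + k), memℓp_two_of_sq (summable_sq_shift hh k)⟩

lemma hankelRow_apply (k m : ℤ) : (hankelRow hh k) m = (h (m + k) : ℂ) := rfl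

lemma orthonormal_hankelRow : Orthonormal ℂ (hankelRow hh) := by
  rw [orthonormal_iff_ite]
  intro k l
  refine (lp.hasSum_inner _ _).unique ?_
  have := Complex.hasSum_ofReal.2 (hh k l)
  have e : (((if k = l then 1 else 0 : ℝ)) : ℂ) = if k = l then 1 else 0 := by split_ifs <;> simp
  rw [e] at this
  refine this.congr_fun fun m => ?_
  simp [hankelRow_apply, mul_comm]

/-- The Hankel transform as a linear isometry of `ℓ²(ℤ)`. -/
noncomputable def hankelIsometry : lp (fun _ : ℤ => ℂ) 2 →ₗᵢ[ℂ] lp (fun _ : ℤ => ℂ) 2 :=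
  (orthonormal_hankelRow hh).orthogonalFamily.linearIsometry

lemma hankelIsometry_apply (u : lp (fun _ : ℤ => ℂ) 2) (k : ℤ) :
    hankelIsometry hh u k = hankel h u k := by
  have h1 := (orthonormal_hankelRow hh).orthogonalFamily.hasSum_linearIsometry u
  have h2 := h1.mapL (lp.evalCLM ℂ (fun _ : ℤ => ℂ) 2 k)
  rw [hankel, hankelIsometry]
  refine (HasSum.tsum_eq ?_).symm
  refine h2.congr_fun fun m => ?_
  -- The isometry superposes rows while `hankel` pairs with one row; these agree because the matrix
  -- is symmetric.
  change u m * (h (m + k) : ℂ) = u m * (h (k + m) : ℂ)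
  rw [add_comm]

variable {u v : ℤ → ℂ} (hu : Summable fun m => ‖u m‖ ^ 2) (hv : Summable fun m => ‖v m‖ ^ 2)
include hu

lemma summable_hankel_term (k : ℤ) : Summable fun m => ‖u m * (h (m + k) : ℂ)‖ :=
  summable_norm_mul_of_sq hu (summable_sq_shift hh k)

lemma summable_sq_hankel : Summable fun k => ‖hankel h u k‖ ^ 2 := by
  have := sq_of_memℓp_two (lp.memℓp (hankelIsometry hh ⟨u, memℓp_two_of_sq hu⟩))
  simpa only [hankelIsometry_apply] using this

lemma hankel_hankel (k : ℤ) : hankel h (hankel h u) k = u k := by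
  let U : lp (fun _ : ℤ => ℂ) 2 := ⟨u, memℓp_two_of_sq hu⟩
  have h1 : hankelIsometry hh (lp.single 2 k 1) = hankelRow hh k := by
    rw [hankelIsometry, OrthogonalFamily.linearIsometry_apply_single]
    simp
  have h2 := (hankelIsometry hh).inner_map_map (lp.single 2 k 1) U
  rw [h1, lp.inner_single_left (𝕜 := ℂ) (G := fun _ : ℤ => ℂ)] at h2
  have h3 := (lp.hasSum_inner (𝕜 := ℂ) (G := fun _ : ℤ => ℂ) (hankelRow hh k)
    (hankelIsometry hh U)).tsum_eq
  rw [h2] at h3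
  simp only [hankelIsometry_apply] at h3
  rw [hankel]
  simpa [hankelRow, U] using h3

include hv

lemma tsum_hankel_mul_conj :
    ∑' k, hankel h u k * conj (hankel h v k) = ∑' m, u m * conj (v m) := by
  let U : lp (fun _ : ℤ => ℂ) 2 := ⟨u, memℓp_two_of_sq hu⟩
  let V : lp (fun _ : ℤ => ℂ) 2 := ⟨v, memℓp_two_of_sq hv⟩
  have h1 := (hankelIsometry hh).inner_map_map V U
  rw [lp.inner_eq_tsum, lp.inner_eq_tsum] at h1
  simpa only [hankelIsometry_apply, RCLike.inner_apply, U, V] using h1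

lemma tsum_mul_conj_hankel :
    ∑' m, u m * conj (hankel h v m) = ∑' k, hankel h u k * conj (v k) := by
  rw [← tsum_hankel_mul_conj hh hu (summable_sq_hankel hh hv)]
  simp only [hankel_hankel hh hv]

end Hankel

/-! ### The wavelet transform on sequences. -/

/-- The wavelet transform on the lattice, up to normalization: `i` is the scale, `j` the position,
`P` the Fourier transform of the wavelet. -/
noncomputable def hankelWavelet (h : ℤ → ℝ) (P u : ℤ → ℂ) (i j : ℤ) : ℂ :=
  hankel h (fun k => hankel h u k * conj (P (i + k))) j

lemma summable_sq_add_left {P : ℤ → ℂ} (hP : Summable fun m => ‖P m‖ ^ 2) (i : ℤ) :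
    Summable fun k => ‖P (i + k)‖ ^ 2 :=
  (Equiv.addLeft i).summable_iff.2 hP

section HankelWavelet
variable {h : ℤ → ℝ}
  (hh : ∀ k l : ℤ, HasSum (fun m => h (m + k) * h (m + l)) (if k = l then 1 else 0))
  {P u v : ℤ → ℂ} (hP : Summable fun m => ‖P m‖ ^ 2)
  (hu : Summable fun m => ‖u m‖ ^ 2) (hv : Summable fun m => ‖v m‖ ^ 2)
include hh hP hu

lemma summable_sq_hankel_mul_conj (i : ℤ) :
    Summable fun k => ‖hankel h u k * conj (P (i + k))‖ ^ 2 :=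
  summable_sq_mul (summable_sq_hankel hh hu) (v := fun k => conj (P (i + k)))
    (by simpa using summable_sq_add_left hP i)

lemma summable_norm_sq_hankelWavelet_row (i : ℤ) :
    Summable fun j => ‖hankelWavelet h P u i j‖ ^ 2 := by
  have h1 := summable_sq_hankel hh (summable_sq_hankel_mul_conj hh hP hu i)
  exact h1

lemma tsum_norm_sq_hankelWavelet (i : ℤ) :
    ∑' j, ‖hankelWavelet h P u i j‖ ^ 2 = ∑' k, ‖hankel h u k‖ ^ 2 * ‖P (i + k)‖ ^ 2 := by
  have h1 := summable_sq_hankel_mul_conj hh hP hu i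
  have h2 := tsum_hankel_mul_conj hh h1 h1
  simp only [Complex.mul_conj, Complex.normSq_eq_norm_sq] at h2
  rw [← Complex.ofReal_tsum, ← Complex.ofReal_tsum, Complex.ofReal_inj] at h2
  simpa [hankelWavelet, mul_pow] using h2

/-- By Tonelli and Parseval in $j$, it remains to sum $|Hu(k)|^2|P(i+k)|^2$, a sheared product of
two summable sequences. -/
lemma summable_norm_sq_hankelWavelet :
    Summable fun x : ℤ × ℤ => ‖hankelWavelet h P u x.1 x.2‖ ^ 2 := by
  rw [summable_prod_of_nonneg fun _ => sq_nonneg _]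
  refine ⟨summable_norm_sq_hankelWavelet_row hh hP hu, ?_⟩
  simp only [tsum_norm_sq_hankelWavelet hh hP hu]
  have := (summable_correlation_prod (a := fun k => ‖hankel h u k‖ ^ 2)
    (b := fun k => ‖P k‖ ^ 2) (by simpa using summable_sq_hankel hh hu) (by simpa using hP)).prod
  simpa using this

include hv

lemma summable_hankelWavelet_mul_conj :
    Summable fun x : ℤ × ℤ =>
      ‖hankelWavelet h P u x.1 x.2 * conj (hankelWavelet h P v x.1 x.2)‖ := by
  have h1 := summable_norm_sq_hankelWavelet hh hP hu
  have h2 := summable_norm_sq_hankelWavelet hh hP hv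
  generalize hankelWavelet h P u = U at *
  generalize hankelWavelet h P v = V at *
  exact summable_mul_conj_of_sq h1 h2

lemma tsum_hankelWavelet_row_mul_conj (i : ℤ) :
    ∑' j, hankelWavelet h P u i j * conj (hankelWavelet h P v i j) =
      ∑' k, hankel h u k * conj (hankel h v k) * ((‖P (i + k)‖ ^ 2 : ℝ) : ℂ) := by
  have h1 := tsum_hankel_mul_conj hh (summable_sq_hankel_mul_conj hh hP hu i)
    (summable_sq_hankel_mul_conj hh hP hv i)
  refine h1.trans (tsum_congr fun k => ?_)
  rw [← Complex.normSq_eq_norm_sq, ← Complex.mul_conj]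
  simp only [map_mul, Complex.conj_conj]
  ring

lemma tsum_hankelWavelet_mul_conj :
    ∑' (j : ℤ) (i : ℤ), hankelWavelet h P u i j * conj (hankelWavelet h P v i j) =
      (∑' m, u m * conj (v m)) * ((∑' i, ‖P i‖ ^ 2 : ℝ) : ℂ) := by
  have h0 : ∑' (j : ℤ) (i : ℤ), hankelWavelet h P u i j * conj (hankelWavelet h P v i j) =
      ∑' (i : ℤ) (j : ℤ), hankelWavelet h P u i j * conj (hankelWavelet h P v i j) := by
    have := (summable_hankelWavelet_mul_conj hh hP hu hv).of_norm
    generalize hankelWavelet h P u = U at this ⊢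
    generalize hankelWavelet h P v = V at this ⊢
    exact Summable.tsum_comm (f := fun i j => U i j * conj (V i j)) this
  rw [h0, tsum_congr (tsum_hankelWavelet_row_mul_conj hh hP hu hv),
    ← tsum_hankel_mul_conj hh hu hv]
  have h2 := summable_mul_conj_of_sq (summable_sq_hankel hh hu) (summable_sq_hankel hh hv)
  generalize hankel h u = U at *
  generalize hankel h v = V at *
  have h3 := summable_correlation_prod (a := fun k => ‖U k * conj (V k)‖)
    (b := fun k => ‖P k‖ ^ 2) (by simpa using h2) (by simpa using hP)
  have h4 : Summable fun x : ℤ × ℤ =>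
      U x.2 * conj (V x.2) * ((‖P (x.1 + x.2)‖ ^ 2 : ℝ) : ℂ) :=
    Summable.of_norm (h3.congr fun x => by simp)
  rw [h4.prod_symm.tsum_comm, ← tsum_mul_right]
  refine tsum_congr fun k => ?_
  -- For fixed $k$ the sum over scales does not depend on $k$: this is where the admissibility
  -- constant factors out.
  rw [tsum_mul_left, ← Complex.ofReal_tsum, ← (Equiv.addRight k).tsum_eq fun i => ‖P i‖ ^ 2]
  rfl

end HankelWavelet

/-! ### From $q$-integrals to sequences. -/

/-- The values of `f` on the lattice, weighted so that `L_{q,2,v}` becomes `ℓ²(ℤ)`. -/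
noncomputable def latticeSeq (q α : ℝ) (n : ℕ) (f : ℝ → ℂ) (m : ℤ) : ℂ :=
  f (q ^ m) * ((ratio q α n ^ m : ℝ) : ℂ)

section
variable {q : ℝ} (hq0 : 0 < q)
include hq0

lemma ratio_zpow_ne_zero (α : ℝ) (n : ℕ) (m : ℤ) : ratio q α n ^ m ≠ 0 :=
  (zpow_pos (ratio_pos hq0 α n) m).ne'

lemma zpow_rpow_eq_ratio_sq (α : ℝ) (n : ℕ) (m : ℤ) :
    (q ^ m) ^ (2 * absV α n + 2) = (ratio q α n ^ m) ^ 2 := by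
  rw [rpow_zpow_comm hq0, ratio, sq, ← mul_zpow, ← Real.rpow_add hq0]
  congr 2; ring

/-- The mass $q^m$ times the weight is the square of `ratio ^ m`, so each factor of a sesquilinear
integrand absorbs one copy. -/
lemma weight_zpow (α : ℝ) (n : ℕ) (m : ℤ) :
    weight α n (q ^ m) = (ratio q α n ^ m) ^ 2 / q ^ m := by
  have h := zpow_pos hq0 m
  rw [eq_div_iff h.ne', ← zpow_rpow_eq_ratio_sq hq0, weight, ← Real.rpow_add_one h.ne']
  congr 1; ring

lemma zpow_mul_norm_rpow (α : ℝ) (n : ℕ) (f : ℝ → ℂ) (m : ℤ) :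
    q ^ m • (‖f (q ^ m)‖ ^ (2 : ℝ) * weight α n (q ^ m)) = ‖latticeSeq q α n f m‖ ^ 2 := by
  have h := (zpow_pos hq0 m).ne'
  rw [weight_zpow hq0, latticeSeq, norm_mul, mul_pow, Complex.norm_real, Real.norm_eq_abs, sq_abs,
    smul_eq_mul, Real.rpow_two]
  field_simp

lemma memLq_two_iff (α : ℝ) (n : ℕ) (f : ℝ → ℂ) :
    MemLq q 2 α n f ↔ Summable fun m => ‖latticeSeq q α n f m‖ ^ 2 := by
  simp only [MemLq, QIntegrable, zpow_mul_norm_rpow hq0, norm_pow, norm_norm]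

lemma zpow_smul_mul_conj_weight (α : ℝ) (n : ℕ) (f g : ℝ → ℂ) (m : ℤ) :
    q ^ m • (f (q ^ m) * conj (g (q ^ m)) * (weight α n (q ^ m) : ℂ)) =
      latticeSeq q α n f m * conj (latticeSeq q α n g m) := by
  have h : ((q ^ m : ℝ) : ℂ) ≠ 0 := Complex.ofReal_ne_zero.2 (zpow_pos hq0 m).ne'
  rw [weight_zpow hq0, latticeSeq, latticeSeq, map_mul, Complex.conj_ofReal, Complex.real_smul,
    Complex.ofReal_div, Complex.ofReal_pow]
  field_simp

lemma latticeSeq_dilate (α : ℝ) (n : ℕ) (Ψ : ℝ → ℂ) (i m : ℤ) :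
    latticeSeq q α n (dilate α n Ψ (q ^ i)) m =
      ((ratio q α n ^ i : ℝ) : ℂ)⁻¹ * latticeSeq q α n Ψ (m - i) := by
  have h : ((ratio q α n ^ i : ℝ) : ℂ) ≠ 0 :=
    Complex.ofReal_ne_zero.2 (ratio_zpow_ne_zero hq0 α n i)
  rw [latticeSeq, latticeSeq, dilate, zpow_rpow_eq_ratio_sq hq0, ← zpow_sub₀ hq0.ne',
    zpow_sub₀ (ratio_pos hq0 α n).ne', Complex.ofReal_div, Complex.ofReal_div, Complex.ofReal_pow,
    Complex.ofReal_one]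
  field_simp

lemma summable_sq_latticeSeq_dilate {α : ℝ} {n : ℕ} {Ψ : ℝ → ℂ}
    (hΨ : Summable fun m => ‖latticeSeq q α n Ψ m‖ ^ 2) (i : ℤ) :
    Summable fun m => ‖latticeSeq q α n (dilate α n Ψ (q ^ i)) m‖ ^ 2 := by
  simp only [latticeSeq_dilate hq0, norm_mul, mul_pow]
  exact ((Equiv.subRight i).summable_iff.2 hΨ).mul_left _

end

section
variable {q : ℝ} (hq0 : 0 < q) (hq1 : q < 1) {α : ℝ} {n : ℕ} (hv : -1 < absV α n)
include hq0 hq1 hv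

lemma genQBessel_zpow (s : ℤ) :
    genQBessel q α (-n) (q ^ s) = kernel q α n s / (kernelConst q α n * ratio q α n ^ s) := by
  have h1 := kernelConst_ne_zero hq0 hq1 hv
  have h2 := ratio_zpow_ne_zero hq0 α n s
  rw [kernel]
  field_simp

lemma zpow_smul_fourierIntegrand (f : ℝ → ℂ) (k m : ℤ) :
    q ^ m • fourierIntegrand q α n f (q ^ k) (q ^ m) =
      ((kernelConst q α n * ratio q α n ^ k : ℝ) : ℂ)⁻¹ *
        (latticeSeq q α n f m * (kernel q α n (m + k) : ℂ)) := by
  have h : ((q ^ m : ℝ) : ℂ) ≠ 0 := Complex.ofReal_ne_zero.2 (zpow_pos hq0 m).ne'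
  have h1 := Complex.ofReal_ne_zero.2 (kernelConst_ne_zero hq0 hq1 hv)
  have h2 := fun m => Complex.ofReal_ne_zero.2 (ratio_zpow_ne_zero hq0 α n m)
  have h3 := h2 k
  have h4 := h2 m
  rw [fourierIntegrand, ← zpow_add₀ hq0.ne', genQBessel_zpow hq0 hq1 hv, weight_zpow hq0,
    latticeSeq, Complex.real_smul, zpow_add₀ (ratio_pos hq0 α n).ne']
  simp only [Complex.ofReal_div, Complex.ofReal_mul, Complex.ofReal_pow]
  field_simp

lemma qIntegrable_fourierIntegrand {f : ℝ → ℂ}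
    (hf : Summable fun m => ‖latticeSeq q α n f m‖ ^ 2) (k : ℤ) :
    QIntegrable q (fourierIntegrand q α n f (q ^ k)) := by
  simp only [QIntegrable, zpow_smul_fourierIntegrand hq0 hq1 hv, norm_mul _⁻¹]
  exact (summable_hankel_term (hasSum_kernel_mul_kernel hq0 hq1 hv) hf k).mul_left _

lemma fourier_zpow (f : ℝ → ℂ) (k : ℤ) :
    fourier q α n f (q ^ k) =
      hankel (kernel q α n) (latticeSeq q α n f) k / ((ratio q α n ^ k : ℝ) : ℂ) := by
  have h1 : ((kernelConst q α n : ℝ) : ℂ) ≠ 0 :=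
    Complex.ofReal_ne_zero.2 (kernelConst_ne_zero hq0 hq1 hv)
  have h2 := Complex.ofReal_ne_zero.2 (ratio_zpow_ne_zero hq0 α n k)
  rw [fourier, qIntegral, Complex.real_smul, ← mul_assoc, ← Complex.ofReal_mul]
  change ((kernelConst q α n : ℝ) : ℂ) * _ = _
  simp only [zpow_smul_fourierIntegrand hq0 hq1 hv]
  rw [tsum_mul_left, ← hankel, Complex.ofReal_mul]
  field_simp

/-- The normalization $a^{-(2|v|+2)}$ makes dilation act on the Fourier side as a pure shift of the
index, with no factor left. -/
lemma fourier_dilate (Ψ : ℝ → ℂ) (i k : ℤ) :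
    fourier q α n (dilate α n Ψ (q ^ i)) (q ^ k) = fourier q α n Ψ (q ^ (i + k)) := by
  have h2 := fun m => Complex.ofReal_ne_zero.2 (ratio_zpow_ne_zero hq0 α n m)
  have h3 := h2 i
  have h4 := h2 k
  rw [fourier_zpow hq0 hq1 hv, fourier_zpow hq0 hq1 hv, hankel,
    ← (Equiv.addRight i).tsum_eq, hankel, zpow_add₀ (ratio_pos hq0 α n).ne']
  simp only [latticeSeq_dilate hq0, Equiv.coe_addRight, add_sub_cancel_right, mul_assoc]
  rw [tsum_mul_left, Complex.ofReal_mul]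
  simp only [add_assoc]
  field_simp

omit hq1 hv in
lemma zpow_smul_admissible (Ψ : ℝ → ℂ) (m : ℤ) :
    q ^ m • (‖fourier q α n Ψ (q ^ m)‖ ^ 2 / q ^ m) = ‖fourier q α n Ψ (q ^ m)‖ ^ 2 := by
  have h := (zpow_pos hq0 m).ne'
  rw [smul_eq_mul]
  field_simp

lemma zpow_smul_translationIntegrand (Ψ : ℝ → ℂ) (i j k m : ℤ) :
    q ^ k • translationIntegrand q α n (q ^ j) (dilate α n Ψ (q ^ i)) (q ^ m) (q ^ k) =
      ((kernelConst q α n ^ 2 * ratio q α n ^ j * ratio q α n ^ m : ℝ) : ℂ)⁻¹ *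
        (fourier q α n Ψ (q ^ (i + k)) * (kernel q α n (k + j) : ℂ) *
          (kernel q α n (k + m) : ℂ)) := by
  have h : ((q ^ k : ℝ) : ℂ) ≠ 0 := Complex.ofReal_ne_zero.2 (zpow_pos hq0 k).ne'
  have h1 := Complex.ofReal_ne_zero.2 (kernelConst_ne_zero hq0 hq1 hv)
  have h2 := fun m => Complex.ofReal_ne_zero.2 (ratio_zpow_ne_zero hq0 α n m)
  have h3 := h2 k
  have h4 := h2 m
  have h5 := h2 j
  rw [translationIntegrand, ← zpow_add₀ hq0.ne', ← zpow_add₀ hq0.ne',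
    genQBessel_zpow hq0 hq1 hv, genQBessel_zpow hq0 hq1 hv, weight_zpow hq0,
    fourier_dilate hq0 hq1 hv, Complex.real_smul, zpow_add₀ (ratio_pos hq0 α n).ne',
    zpow_add₀ (ratio_pos hq0 α n).ne', add_comm m, add_comm j]
  simp only [Complex.ofReal_div, Complex.ofReal_mul, Complex.ofReal_pow]
  field_simp

lemma summable_sq_translate {Ψ : ℝ → ℂ} (hP : Summable fun m : ℤ => ‖fourier q α n Ψ (q ^ m)‖ ^ 2)
    (i j : ℤ) :
    Summable fun k => ‖fourier q α n Ψ (q ^ (i + k)) * (kernel q α n (k + j) : ℂ)‖ ^ 2 :=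
  summable_sq_mul ((Equiv.addLeft i).summable_iff.2 hP)
    (summable_sq_shift (hasSum_kernel_mul_kernel hq0 hq1 hv) j)

lemma qIntegrable_translationIntegrand {Ψ : ℝ → ℂ}
    (hP : Summable fun m : ℤ => ‖fourier q α n Ψ (q ^ m)‖ ^ 2) (i j m : ℤ) :
    QIntegrable q (translationIntegrand q α n (q ^ j) (dilate α n Ψ (q ^ i)) (q ^ m)) := by
  simp only [QIntegrable, zpow_smul_translationIntegrand hq0 hq1 hv, norm_mul _⁻¹]
  exact (summable_hankel_term (hasSum_kernel_mul_kernel hq0 hq1 hv)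
    (summable_sq_translate hq0 hq1 hv hP i j) m).mul_left _

/-- The translation integral is itself a Hankel transform, which places the wavelet copies in
$\ell^2$. -/
lemma latticeSeq_waveletCopy (Ψ : ℝ → ℂ) (i j m : ℤ) :
    latticeSeq q α n (waveletCopy q α n Ψ (q ^ i) (q ^ j)) m =
      ((√(q ^ i) / (kernelConst q α n * ratio q α n ^ j) : ℝ) : ℂ) *
        hankel (kernel q α n)
          (fun k => fourier q α n Ψ (q ^ (i + k)) * (kernel q α n (k + j) : ℂ)) m := by
  have h1 : ((kernelConst q α n : ℝ) : ℂ) ≠ 0 :=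
    Complex.ofReal_ne_zero.2 (kernelConst_ne_zero hq0 hq1 hv)
  have h2 := fun m => Complex.ofReal_ne_zero.2 (ratio_zpow_ne_zero hq0 α n m)
  have h4 := h2 m
  have h5 := h2 j
  have h6 : translation q α n (q ^ j) (dilate α n Ψ (q ^ i)) (q ^ m) =
      ((kernelConst q α n : ℝ) : ℂ) *
        ∑' k : ℤ, q ^ k • translationIntegrand q α n (q ^ j) (dilate α n Ψ (q ^ i)) (q ^ m) (q ^ k)
      := by
    rw [translation, qIntegral, Complex.real_smul, ← mul_assoc, ← Complex.ofReal_mul, kernelConst]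
  simp only [zpow_smul_translationIntegrand hq0 hq1 hv] at h6
  rw [tsum_mul_left] at h6
  rw [latticeSeq, waveletCopy, h6, hankel]
  simp only [Complex.ofReal_div, Complex.ofReal_mul, Complex.ofReal_pow]
  field_simp

lemma qIntegrable_waveletIntegrand {Ψ f : ℝ → ℂ}
    (hP : Summable fun m : ℤ => ‖fourier q α n Ψ (q ^ m)‖ ^ 2)
    (hf : Summable fun m => ‖latticeSeq q α n f m‖ ^ 2) (i j : ℤ) :
    QIntegrable q (waveletIntegrand q α n Ψ f (q ^ i) (q ^ j)) := by
  simp only [QIntegrable, waveletIntegrand, zpow_smul_mul_conj_weight hq0]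
  refine summable_mul_conj_of_sq hf ?_
  simp only [latticeSeq_waveletCopy hq0 hq1 hv, norm_mul, mul_pow]
  exact (summable_sq_hankel (hasSum_kernel_mul_kernel hq0 hq1 hv)
    (summable_sq_translate hq0 hq1 hv hP i j)).mul_left _

lemma waveletTransform_zpow {Ψ f : ℝ → ℂ}
    (hP : Summable fun m : ℤ => ‖fourier q α n Ψ (q ^ m)‖ ^ 2)
    (hf : Summable fun m => ‖latticeSeq q α n f m‖ ^ 2) (i j : ℤ) :
    waveletTransform q α n Ψ f (q ^ i) (q ^ j) =
      ((√(q ^ i) / ratio q α n ^ j : ℝ) : ℂ) *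
        hankelWavelet (kernel q α n) (fun m => fourier q α n Ψ (q ^ m)) (latticeSeq q α n f) i j := by
  have h1 : ((kernelConst q α n : ℝ) : ℂ) ≠ 0 :=
    Complex.ofReal_ne_zero.2 (kernelConst_ne_zero hq0 hq1 hv)
  have h2 := Complex.ofReal_ne_zero.2 (ratio_zpow_ne_zero hq0 α n j)
  -- Self-adjointness moves $H$ from the wavelet copy onto $f$; the remaining real factor $h(k+j)$
  -- is the kernel of the outer transform.
  have h3 := tsum_mul_conj_hankel (hasSum_kernel_mul_kernel hq0 hq1 hv) hf
    (summable_sq_translate hq0 hq1 hv hP i j)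
  have h4 : waveletTransform q α n Ψ f (q ^ i) (q ^ j) = ((kernelConst q α n : ℝ) : ℂ) *
      ∑' m : ℤ, q ^ m • waveletIntegrand q α n Ψ f (q ^ i) (q ^ j) (q ^ m) := by
    rw [waveletTransform, qIntegral, Complex.real_smul, ← mul_assoc, ← Complex.ofReal_mul,
      kernelConst]
  simp only [waveletIntegrand, zpow_smul_mul_conj_weight hq0, latticeSeq_waveletCopy hq0 hq1 hv,
    map_mul, Complex.conj_ofReal, mul_left_comm (latticeSeq q α n f _)] at h4
  rw [h4, tsum_mul_left, h3, hankelWavelet, hankel]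
  simp only [Complex.ofReal_div, Complex.ofReal_mul, map_mul, Complex.conj_ofReal, mul_assoc]
  field_simp

/-- The measure is tuned to cancel: $(\sqrt a)^2$ against the mass $a$ over $a^2$, and `ratio ^ j`
squared in the denominator against the weight and mass in $b$. -/
lemma smul_waveletTransform_mul_conj {Ψ f g : ℝ → ℂ}
    (hP : Summable fun m : ℤ => ‖fourier q α n Ψ (q ^ m)‖ ^ 2)
    (hf : Summable fun m => ‖latticeSeq q α n f m‖ ^ 2)
    (hg : Summable fun m => ‖latticeSeq q α n g m‖ ^ 2) (i j : ℤ) :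
    (q ^ i * q ^ j) • (waveletTransform q α n Ψ f (q ^ i) (q ^ j) *
        conj (waveletTransform q α n Ψ g (q ^ i) (q ^ j)) * (weight α n (q ^ j) : ℂ) /
          ((q ^ i : ℝ) : ℂ) ^ 2) =
      hankelWavelet (kernel q α n) (fun m => fourier q α n Ψ (q ^ m)) (latticeSeq q α n f) i j *
      conj (hankelWavelet (kernel q α n) (fun m => fourier q α n Ψ (q ^ m))
        (latticeSeq q α n g) i j) := by
  have hi : ((q ^ i : ℝ) : ℂ) ≠ 0 := Complex.ofReal_ne_zero.2 (zpow_pos hq0 i).ne'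
  have hj : ((q ^ j : ℝ) : ℂ) ≠ 0 := Complex.ofReal_ne_zero.2 (zpow_pos hq0 j).ne'
  have h2 := Complex.ofReal_ne_zero.2 (ratio_zpow_ne_zero hq0 α n j)
  have h3 : ((√(q ^ i) : ℝ) : ℂ) ^ 2 = ((q ^ i : ℝ) : ℂ) := by
    rw [← Complex.ofReal_pow, Real.sq_sqrt (zpow_pos hq0 i).le]
  rw [waveletTransform_zpow hq0 hq1 hv hP hf, waveletTransform_zpow hq0 hq1 hv hP hg,
    weight_zpow hq0, Complex.real_smul]
  simp only [Complex.ofReal_div, Complex.ofReal_mul, Complex.ofReal_pow, map_mul, map_div₀,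
    Complex.conj_ofReal]
  field_simp
  rw [h3]

lemma smul_norm_sq_waveletTransform {Ψ f : ℝ → ℂ}
    (hP : Summable fun m : ℤ => ‖fourier q α n Ψ (q ^ m)‖ ^ 2)
    (hf : Summable fun m => ‖latticeSeq q α n f m‖ ^ 2) (i j : ℤ) :
    (q ^ i * q ^ j) • (‖waveletTransform q α n Ψ f (q ^ i) (q ^ j)‖ ^ 2 * weight α n (q ^ j) /
        (q ^ i) ^ 2) =
      ‖hankelWavelet (kernel q α n) (fun m => fourier q α n Ψ (q ^ m)) (latticeSeq q α n f) i j‖ ^ 2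
      := by
  have h := smul_waveletTransform_mul_conj hq0 hq1 hv hP hf hf i j
  rw [Complex.mul_conj, Complex.mul_conj, Complex.normSq_eq_norm_sq, Complex.normSq_eq_norm_sq,
    Complex.real_smul] at h
  rw [smul_eq_mul]
  exact_mod_cast h

end

lemma qIntegral₂_eq {E : Type*} [NormedAddCommGroup E] [NormedSpace ℝ E] (q : ℝ)
    (F : ℝ → ℝ → E) :
    qIntegral₂ q F =
      (1 - q) ^ 2 • ∑' (j : ℤ) (i : ℤ), (q ^ i * q ^ j) • F (q ^ i) (q ^ j) := by
  have : ∀ j : ℤ, q ^ j • (1 - q) • ∑' i : ℤ, q ^ i • F (q ^ i) (q ^ j) =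
      (1 - q) • ∑' i : ℤ, (q ^ i * q ^ j) • F (q ^ i) (q ^ j) := fun j => by
    rw [smul_comm, ← tsum_const_smul'']
    simp only [smul_smul, mul_comm]
  simp only [qIntegral₂, qIntegral, this]
  rw [tsum_const_smul'', smul_smul, sq]

end QBessel

/-! ### The theorem. -/

open QBessel in
theorem mainTheorem2 (q : ℝ) (hq0 : 0 < q) (hq1 : q < 1) (α : ℝ) (n : ℕ)
    (hv : -1 < QBessel.absV α n) (Ψ : ℝ → ℂ) (hΨ : QBessel.IsWavelet q α n Ψ)
    (hΨ0 : ∃ x ∈ QBessel.lattice q, Ψ x ≠ 0) :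
    -- the admissibility constant is positive, and all the integrals converge absolutely
    (0 < QBessel.admConst q α n Ψ ∧
      (∀ f : ℝ → ℂ, QBessel.MemLq q 2 α n f → ∀ x ∈ QBessel.lattice q,
        QBessel.QIntegrable q (QBessel.fourierIntegrand q α n f x)) ∧
      (∀ a ∈ QBessel.lattice q, QBessel.MemLq q 2 α n (QBessel.dilate α n Ψ a) ∧
        ∀ b ∈ QBessel.lattice q, ∀ x ∈ QBessel.lattice q,
          QBessel.QIntegrable q
            (QBessel.translationIntegrand q α n b (QBessel.dilate α n Ψ a) x)) ∧
      (∀ f : ℝ → ℂ, QBessel.MemLq q 2 α n f →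
        ∀ a ∈ QBessel.lattice q, ∀ b ∈ QBessel.lattice q,
          QBessel.QIntegrable q (QBessel.waveletIntegrand q α n Ψ f a b))) ∧
    -- Plancherel
    (∀ f : ℝ → ℂ, QBessel.MemLq q 2 α n f →
      QBessel.QIntegrable₂ q (fun a b =>
        ‖QBessel.waveletTransform q α n Ψ f a b‖ ^ 2 * QBessel.weight α n b / a ^ 2) ∧
      1 / QBessel.admConst q α n Ψ * QBessel.qIntegral₂ q (fun a b =>
        ‖QBessel.waveletTransform q α n Ψ f a b‖ ^ 2 * QBessel.weight α n b / a ^ 2) =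
        QBessel.normLq q 2 α n f ^ 2) ∧
    -- Parseval
    (∀ f g : ℝ → ℂ, QBessel.MemLq q 2 α n f → QBessel.MemLq q 2 α n g →
      QBessel.QIntegrable q (fun x =>
        f x * (starRingEnd ℂ) (g x) * (QBessel.weight α n x : ℂ)) ∧
      QBessel.QIntegrable₂ q (fun a b =>
        QBessel.waveletTransform q α n Ψ f a b *
          (starRingEnd ℂ) (QBessel.waveletTransform q α n Ψ g a b) *
          (QBessel.weight α n b : ℂ) / (a : ℂ) ^ 2) ∧
      QBessel.qIntegral q (fun x =>
        f x * (starRingEnd ℂ) (g x) * (QBessel.weight α n x : ℂ)) =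
        1 / (QBessel.admConst q α n Ψ : ℂ) * QBessel.qIntegral₂ q (fun a b =>
          QBessel.waveletTransform q α n Ψ f a b *
            (starRingEnd ℂ) (QBessel.waveletTransform q α n Ψ g a b) *
            (QBessel.weight α n b : ℂ) / (a : ℂ) ^ 2)) := by
  have hh := hasSum_kernel_mul_kernel hq0 hq1 hv
  have hψ := (memLq_two_iff hq0 α n Ψ).1 hΨ.memLq
  -- The measure $d_qa/a$ is $1-q$ times counting measure on the lattice, so admissibility says that
  -- $P$ is in $\ell^2$.
  have hP : Summable fun m : ℤ => ‖fourier q α n Ψ (q ^ m)‖ ^ 2 := by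
    simpa only [QIntegrable, zpow_smul_admissible hq0, norm_pow, norm_norm] using hΨ.admissible
  have hC : admConst q α n Ψ = (1 - q) * ∑' m : ℤ, ‖fourier q α n Ψ (q ^ m)‖ ^ 2 := by
    simp only [admConst, qIntegral, zpow_smul_admissible hq0, smul_eq_mul]
  have hpos : 0 < ∑' m : ℤ, ‖fourier q α n Ψ (q ^ m)‖ ^ 2 := by
    refine (tsum_nonneg fun _ => sq_nonneg _).lt_of_ne fun h0 => ?_
    have h1 := (hasSum_zero_iff_of_nonneg fun _ => sq_nonneg _).1 (h0 ▸ hP.hasSum)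
    -- If the constant vanished, so would the transform of the wavelet, and the involution would
    -- make the wavelet zero on the lattice.
    have h2 : hankel (kernel q α n) (latticeSeq q α n Ψ) = 0 := by
      ext k
      have h3 := congrFun h1 k
      rw [fourier_zpow hq0 hq1 hv] at h3
      exact (div_eq_zero_iff.1 (norm_eq_zero.1 ((pow_eq_zero_iff two_ne_zero).1 h3))).resolve_right
        (Complex.ofReal_ne_zero.2 (ratio_zpow_ne_zero hq0 α n k))
    obtain ⟨_, ⟨m, rfl⟩, hm⟩ := hΨ0
    have h4 := hankel_hankel hh hψ m
    rw [h2] at h4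
    refine mul_ne_zero hm (Complex.ofReal_ne_zero.2 (ratio_zpow_ne_zero hq0 α n m)) (h4.symm.trans ?_)
    simp [hankel]
  have hCpos : 0 < admConst q α n Ψ := hC ▸ mul_pos (sub_pos.2 hq1) hpos
  refine ⟨⟨hCpos, ?_, ?_, ?_⟩, ?_, ?_⟩
  · rintro f hf _ ⟨k, rfl⟩
    exact qIntegrable_fourierIntegrand hq0 hq1 hv ((memLq_two_iff hq0 α n f).1 hf) k
  · rintro _ ⟨i, rfl⟩
    refine ⟨(memLq_two_iff hq0 α n _).2 (summable_sq_latticeSeq_dilate hq0 hψ i), ?_⟩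
    rintro _ ⟨j, rfl⟩ _ ⟨m, rfl⟩
    exact qIntegrable_translationIntegrand hq0 hq1 hv hP i j m
  · rintro f hf _ ⟨i, rfl⟩ _ ⟨j, rfl⟩
    exact qIntegrable_waveletIntegrand hq0 hq1 hv hP ((memLq_two_iff hq0 α n f).1 hf) i j
  · intro f hf
    have hf' := (memLq_two_iff hq0 α n f).1 hf
    have h1 := smul_norm_sq_waveletTransform hq0 hq1 hv hP hf'
    refine ⟨?_, ?_⟩
    · simp only [QIntegrable₂, h1, norm_pow, norm_norm]
      exact summable_norm_sq_hankelWavelet hh hP hf'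
    · have h2 := tsum_hankelWavelet_mul_conj hh hP hf' hf'
      simp only [Complex.mul_conj, Complex.normSq_eq_norm_sq] at h2
      have h3 : ∑' (j : ℤ) (i : ℤ), ‖hankelWavelet (kernel q α n)
          (fun m => fourier q α n Ψ (q ^ m)) (latticeSeq q α n f) i j‖ ^ 2 =
          (∑' m, ‖latticeSeq q α n f m‖ ^ 2) * ∑' m : ℤ, ‖fourier q α n Ψ (q ^ m)‖ ^ 2 := by
        exact_mod_cast h2
      have h4 : normLq q 2 α n f ^ 2 = (1 - q) * ∑' m, ‖latticeSeq q α n f m‖ ^ 2 := by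
        simp only [normLq, qIntegral, zpow_mul_norm_rpow hq0, smul_eq_mul]
        rw [← Real.sqrt_eq_rpow, Real.sq_sqrt]
        exact mul_nonneg (sub_pos.2 hq1).le (tsum_nonneg fun _ => sq_nonneg _)
      rw [qIntegral₂_eq]
      simp only [h1]
      rw [h3, h4, hC, smul_eq_mul]
      have := (sub_pos.2 hq1).ne'
      field_simp
  · intro f g hf hg
    have hf' := (memLq_two_iff hq0 α n f).1 hf
    have hg' := (memLq_two_iff hq0 α n g).1 hg
    have h1 := smul_waveletTransform_mul_conj hq0 hq1 hv hP hf' hg'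
    refine ⟨?_, ?_, ?_⟩
    · simp only [QIntegrable, zpow_smul_mul_conj_weight hq0]
      exact summable_mul_conj_of_sq hf' hg'
    · simp only [QIntegrable₂, h1]
      exact summable_hankelWavelet_mul_conj hh hP hf' hg'
    · rw [qIntegral₂_eq]
      simp only [h1, qIntegral, zpow_smul_mul_conj_weight hq0]
      rw [tsum_hankelWavelet_mul_conj hh hP hf' hg', hC, Complex.real_smul, Complex.real_smul,
        Complex.ofReal_mul, Complex.ofReal_pow]
      have h2 := Complex.ofReal_ne_zero.2 (sub_pos.2 hq1).ne'
      have h3 := Complex.ofReal_ne_zero.2 hpos.ne'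
      field_simp
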